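/- For complex $s,a$ the Lerch transcendent $\Phi(z,s,a)$ denotes the analytic continuation to the cut plane $|\arg(1-z)|<\pi$ (i.e. $\mathbb C\setminus[1,\infty)$) of the series $\sum_{n=0}^\infty z^n/(a+n)^s$, $|z|<1$. Let $b_n=b_n(a)$ be the Taylor coefficients at $t=0$ of $\tfrac{i}{2}\csc\pi(t-a)$, for $a\notin\mathbb Z$. For $a\notin\mathbb Z$ let $$B(z,s,a)=\frac1{2\pi i}\int_{-i\infty}^{(-a+)}\frac{\Gamma(1+t)\Gamma(-t)(-z)^t}{(a+t)^s}\,dt,$$ where the contour comes up from $-i\infty$ along $t=-a-iy$ with $\arg(a+t)=-\tfrac{\pi}{2}$, goes once in the positive direction around a circle about $-a$ of radius $r<\mathrm{dist}(a,\mathbb Z)$, and returns to $-i\infty$ along the same half-line with $\arg(a+t)=\tfrac{3\pi}{2}$ (the contributions of the two passages of the half-line being taken under one integral sign). Powers $(-z)^t$ and $\ln(-z)$ have their principal values. Let $S$ be an integer and let $a\in\mathbb C$, with $a\notin\mathbb Z$ if $S\ge1$. Then the continuation $\Phi(\cdot,S,a)$ exists, and for every $z$ with $|z|>1$ and $|\arg(1-z)|<\pi$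 the following hold. (i) If $a\notin\mathbb Z$, then, for every admissible radius $r$, $B(z,S,a)=0$ if $S\le 0$, and if $S\ge1$ $$B(z,S,a)=\frac{2\pi i}{(-z)^a}\sum_{n=0}^{S-1}\frac{b_n}{\Gamma(S-n)\,(\ln(-z))^{n-S+1}};$$ moreover $\Phi(z,S,a)=B(z,S,a)-e^{-\pi i S}\sum_{n=1}^\infty \frac{z^{-n}}{(n-a)^S}$. If the closed half-line $\{-a-iy:y\ge0\}$ contains no integer, the integrals along each of the two passages of the half-line converge absolutely. (ii) The series $\sum_{n\ge1}z^{-n}/(n-a)^S$ converges absolutely and $$\Phi(z,S,a)=\frac{2\pi i}{(-z)^a}\sum_{n=0}^{S-1}\frac{b_n}{\Gamma(S-n)\,(\ln(-z))^{n-S+1}}-e^{-\pi i S}\sum_{n=1}^\infty\frac{z^{-n}}{(n-a)^S},$$ where the first term on the right is zero if $S\le0$. -/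

import Mathlib

open Complex MeasureTheory Set

noncomputable section

/-- The principal sheet `|arg (1 - z)| < π`, that is, the plane cut along `[1, ∞)`. -/
def lerchDomain : Set ℂ := {z : ℂ | 1 - z ∈ slitPlane}

/-- `F` is an analytic continuation to the cut plane of the Lerch series
`∑ zⁿ / (a + n)ˢ`, `|z| < 1`. -/
def IsLerchContinuation (s a : ℂ) (F : ℂ → ℂ) : Prop :=
  DifferentiableOn ℂ F lerchDomain ∧
    ∀ z : ℂ, ‖z‖ < 1 → HasSum (fun n : ℕ => z ^ n / (a + (n : ℂ)) ^ s) (F z)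

open Classical in
/-- The Lerch transcendent `Φ(z, s, a)` on its principal branch: the analytic continuation of the
series to the cut plane. The continuation is unique on the cut plane, which is connected; the
value is `0` by convention if there is none. -/
def lerchPhi (z s a : ℂ) : ℂ :=
  if h : ∃ F : ℂ → ℂ, IsLerchContinuation s a F then h.choose z else 0

/-- The Mellin-Barnes integrand `Γ(1+t) Γ(-t) (-z)ᵗ / (a+t)ˢ`, where `(a+t)ˢ = exp (s ℓ)` and
`ℓ` is the value of the logarithm of `a + t` that is continued along the contour. -/
def lerchKernel (z s t ℓ : ℂ) : ℂ :=
  Gamma (1 + t) * Gamma (-t) * (-z) ^ t / exp (s * ℓ)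

/-- The integrand on the half-line `t = -a - i y`, directed to `-i∞` (so `dt = -i dy`), with
`arg (a + t) = φ`. -/
def lerchLeg (z s a : ℂ) (φ y : ℝ) : ℂ :=
  lerchKernel z s (-a - (y : ℂ) * I) ((Real.log y : ℂ) + (φ : ℂ) * I) * (-I)

/-- The integrand on the circle `t = -a + r e^{iθ}` (so `dt = i r e^{iθ} dθ`), with
`arg (a + t) = θ`. -/
def lerchArc (z s a : ℂ) (r θ : ℝ) : ℂ :=
  lerchKernel z s (-a + (r : ℂ) * exp ((θ : ℂ) * I)) ((Real.log r : ℂ) + (θ : ℂ) * I) *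
    ((r : ℂ) * I * exp ((θ : ℂ) * I))

/-- The branch-point contribution
`B(z, s, a) = (1 / 2πi) ∫_{-i∞}^{(-a+)} Γ(1+t) Γ(-t) (-z)ᵗ / (a+t)ˢ dt`.
The contour comes up from `-i∞` along `t = -a - i y` with `arg (a + t) = -π/2`, follows the circle
of radius `r` about `-a` once in the positive direction, and goes back down the same half-line
with `arg (a + t) = 3π/2`. The two passages of the half-line are put under one integral. -/
def lerchB (r : ℝ) (z s a : ℂ) : ℂ :=
  1 / (2 * (Real.pi : ℂ) * I) *
    ((∫ θ in (-(Real.pi / 2))..(3 * Real.pi / 2), lerchArc z s a r θ) +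
      ∫ y in Ioi r, (lerchLeg z s a (3 * Real.pi / 2) y - lerchLeg z s a (-(Real.pi / 2)) y))

/-- The Taylor coefficients at `t = 0` of `(i / 2) csc π(t - a)`. -/
def lerchCoeff (a : ℂ) (n : ℕ) : ℂ :=
  iteratedDeriv n (fun t : ℂ => I / 2 * (1 / sin ((Real.pi : ℂ) * (t - a)))) 0 /
    (n.factorial : ℂ)

/-- `(2πi / (-z)ᵃ) ∑_{n=0}^{S-1} bₙ / (Γ(S-n) (ln(-z))^{n-S+1})`, an empty sum for `S ≤ 0`. -/
def lerchFiniteSum (z : ℂ) (S : ℤ) (a : ℂ) : ℂ :=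
  2 * (Real.pi : ℂ) * I / (-z) ^ a *
    ∑ n ∈ Finset.range S.toNat,
      lerchCoeff a n / (Gamma ((S : ℂ) - (n : ℂ)) * log (-z) ^ ((n : ℤ) - S + 1))

end

/-! Put `z = -e^w`. The function `e^{aw} Φ(-e^w, S, a)` has derivative of the same shape with `S -
1` in place of `S`, and for `S = 0` it is `e^{aw} / (1 + e^w)`, which is holomorphic on `|Im w| < π`
and invariant under `(a, w) ↦ (1 - a, -w)`. Differentiation therefore settles `S ≤ 0`, with no extra
term on the right half of the strip. For `S ≥ 1` one integrates: the right half then carries the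
reflected series plus a polynomial `P`, known up to a constant.

The constant is found at `w = ±πi`, where `-e^w` and `-e^{-w}` both equal `1`. Comparing the two
expansions along `Re w = 0` (`boundary_jump`) prescribes the jump of `e^{-aw} P(w)` between the
endpoints: `0` for `S ≥ 2`, and `-2πi` for `S = 1`, where the series are logarithmic at `1`. The
Taylor coefficients of `e^{uw} (i/2) csc π(u - a)` have this jump after scaling by `2πi`
(`lerchPoly_boundary`), and a constant without jump vanishes because `sin πa ≠ 0`.

The integral `B` is independent of this. For integer `S` the two passages of the half-line cancel,
and Cauchy's formula on the circle gives the same Taylor coefficient. -/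

/-! ### Growth and summability of the series coefficients. -/

open Filter Topology Asymptotics in
theorem tendsto_inv_add_natCast (a : ℂ) : Tendsto (fun n : ℕ => (a + n)⁻¹) atTop (𝓝 0) := by
  refine tendsto_inv₀_cobounded.comp ?_
  rw [← tendsto_norm_atTop_iff_cobounded]
  refine tendsto_atTop_mono (f := fun n : ℕ => (n : ℝ) + -‖a‖) (fun n => ?_)
    (tendsto_atTop_add_const_right _ _ tendsto_natCast_atTop_atTop)
  have h := norm_sub_norm_le (n : ℂ) (-a)
  simp only [norm_neg, sub_neg_eq_add, norm_natCast] at h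
  rw [add_comm a]
  linarith

open Filter Topology in
theorem eventually_add_natCast_ne_zero (a : ℂ) : ∀ᶠ n : ℕ in atTop, a + n ≠ 0 := by
  obtain ⟨N, hN⟩ := exists_nat_gt ‖a‖
  filter_upwards [eventually_ge_atTop N] with n hn h
  have h1 : ‖a‖ = n := by rw [eq_neg_of_add_eq_zero_left h, norm_neg, norm_natCast]
  have h2 : (N : ℝ) ≤ n := by exact_mod_cast hn
  linarith

open Filter Asymptotics in
theorem isBigO_inv_add_natCast (a : ℂ) :
    (fun n : ℕ => (a + n)⁻¹) =O[atTop] (fun n : ℕ => (n : ℝ)⁻¹) := by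
  -- Beyond `2‖a‖` one has `‖a + n‖ ≥ n - ‖a‖ ≥ n / 2`.
  obtain ⟨N, hN⟩ := exists_nat_gt (2 * ‖a‖)
  refine IsBigO.of_bound 2 ?_
  filter_upwards [eventually_ge_atTop N, eventually_gt_atTop 0] with n hn h0
  have h2 : (N : ℝ) ≤ n := by exact_mod_cast hn
  have h3 : (0 : ℝ) < n := by exact_mod_cast h0
  have h := norm_sub_norm_le (n : ℂ) (-a)
  simp only [norm_neg, sub_neg_eq_add, norm_natCast] at h
  rw [add_comm a, norm_inv, norm_inv, Real.norm_natCast, inv_eq_one_div, ← div_eq_mul_inv,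
    div_le_div_iff₀ (by linarith) h3]
  linarith

open Filter in
theorem summable_norm_inv_add_zpow {S : ℤ} (hS : 2 ≤ S) (a : ℂ) :
    Summable (fun n : ℕ => ‖((a + n) ^ S)⁻¹‖) := by
  obtain ⟨m, rfl⟩ := Int.eq_ofNat_of_zero_le (by lia : 0 ≤ S)
  have hm : 1 < m := by exact_mod_cast (by lia : (1 : ℤ) < m)
  refine summable_of_isBigO_nat (Real.summable_nat_pow_inv.2 hm) ?_
  simpa using ((isBigO_inv_add_natCast a).pow m).norm_left

open Filter in
theorem summable_norm_inv_sub_inv (a b : ℂ) :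
    Summable (fun n : ℕ => ‖(a + n)⁻¹ - (b + n)⁻¹‖) := by
  refine summable_of_isBigO_nat (Real.summable_nat_pow_inv.2 one_lt_two) ?_
  have h := (((isBigO_inv_add_natCast a).mul (isBigO_inv_add_natCast b)).const_mul_left
    (b - a)).norm_left
  refine (h.congr' ?_ (Eventually.of_forall fun n => by simp [sq]))
  filter_upwards [eventually_add_natCast_ne_zero a, eventually_add_natCast_ne_zero b] with n h1 h2
  congr 1
  field_simp
  ring

open Filter Topology in
theorem summable_norm_zpow_mul_pow (a : ℂ) (S : ℤ) {q : ℂ} (hq : ‖q‖ < 1) :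
    Summable (fun n : ℕ => ‖((a + n) ^ S)⁻¹ * q ^ n‖) := by
  -- The ratio test needs terms that are eventually nonzero.
  rcases eq_or_ne q 0 with rfl | h0
  · refine summable_of_ne_finset_zero (s := {0}) fun n hn => ?_
    simp [zero_pow (by simpa using hn : n ≠ 0)]
  refine Summable.norm (summable_of_ratio_test_tendsto_lt_one hq ?_ ?_)
  · filter_upwards [eventually_add_natCast_ne_zero a] with n hn
    simp only [ne_eq, mul_eq_zero, inv_eq_zero, pow_eq_zero_iff', h0, false_and, or_false]
    intro h
    exact absurd (eq_zero_of_zpow_eq_zero h) hn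
  · have h1 : Tendsto (fun n : ℕ => ‖(1 + (a + n)⁻¹)‖ ^ (-S) * ‖q‖) atTop
        (𝓝 (‖(1 + 0 : ℂ)‖ ^ (-S) * ‖q‖)) :=
      (((tendsto_const_nhds.add (tendsto_inv_add_natCast a)).norm).zpow₀ _
        (Or.inl (by simp))).mul_const _
    simp only [add_zero, norm_one, one_zpow, one_mul] at h1
    refine h1.congr' ?_
    filter_upwards [eventually_add_natCast_ne_zero a] with n hn
    have h2 : 1 + (a + n)⁻¹ = (a + (n + 1 : ℕ)) / (a + n) := by
      rw [Nat.cast_add, Nat.cast_one, ← add_assoc, add_div, div_self hn, one_div]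
    have h3 := norm_ne_zero_iff.2 hn
    have h5 := norm_ne_zero_iff.2 h0
    rw [h2, norm_mul, norm_mul, norm_pow, norm_pow, norm_inv, norm_inv, norm_zpow, norm_zpow,
      norm_div, div_zpow, zpow_neg, zpow_neg, pow_succ]
    have h4 : ‖a + n‖ ^ S ≠ 0 := zpow_ne_zero _ h3
    field_simp

/-- A convergent power series can be differentiated termwise in the unit disk. -/
theorem hasDerivAt_tsum_mul_pow {c : ℕ → ℂ} (hc : ∀ q : ℂ, ‖q‖ < 1 → Summable fun n => ‖c n * q ^ n‖)
    {q : ℂ} (hq : ‖q‖ < 1) :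
    ∃ d : ℂ, HasDerivAt (fun q => ∑' n, c n * q ^ n) d q ∧
      HasSum (fun n : ℕ => n * (c n * q ^ n)) (q * d) := by
  obtain ⟨ρ, h1, h2⟩ := exists_between hq
  have hρ : 0 ≤ ρ := (norm_nonneg q).trans h1.le
  have hs : Summable fun n => ‖c n * (ρ : ℂ) ^ n‖ := hc ρ (by simpa [abs_of_nonneg hρ] using h2)
  have hd : ∀ n, DifferentiableOn ℂ (fun q : ℂ => c n * q ^ n) (Metric.ball 0 ρ) :=
    fun n => by fun_prop
  have hb : ∀ n, ∀ w ∈ Metric.ball (0 : ℂ) ρ, ‖c n * w ^ n‖ ≤ ‖c n * (ρ : ℂ) ^ n‖ := by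
    intro n w hw
    rw [norm_mul, norm_mul, norm_pow, norm_pow, norm_real, Real.norm_of_nonneg hρ]
    gcongr
    exact (mem_ball_zero_iff.1 hw).le
  have hq' : q ∈ Metric.ball (0 : ℂ) ρ := by simpa using h1
  refine ⟨_, ((differentiableOn_tsum_of_summable_norm hs hd Metric.isOpen_ball hb).differentiableAt
    (Metric.isOpen_ball.mem_nhds hq')).hasDerivAt, ?_⟩
  convert! (hasSum_deriv_of_summable_norm hs hd Metric.isOpen_ball hb hq').mul_left q using 2 with n
  rw [deriv_const_mul _ (by fun_prop), deriv_pow_field]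
  rcases n with _ | n
  · simp
  · simp [pow_succ]; ring

/-! ### The series in the exponential variable. -/

/-- `e^{aw} Φ(-e^w, S, a)` in the left half-plane, as a series. -/
noncomputable def lerchExp (a : ℂ) (S : ℤ) (w : ℂ) : ℂ :=
  exp (a * w) * ∑' n : ℕ, ((a + n) ^ S)⁻¹ * (-exp w) ^ n

theorem norm_neg_exp_lt_one {w : ℂ} (hw : w.re < 0) : ‖-exp w‖ < 1 := by
  rw [norm_neg, norm_exp]
  simpa using Real.exp_lt_exp.2 hw

/-- The `n`-th term is a multiple of `e^{(a+n)w}`, so `d/dw` brings down `a + n` and lowers the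
order by one. A vanishing `a + n` does harm only at `S = 1`: there the term is `0` by the convention
`0⁻¹ = 0`, while at order `0` its coefficient is `0 ^ 0 = 1`. -/
theorem hasDerivAt_lerchExp {a : ℂ} {S : ℤ} (ha : S = 1 → ∀ n : ℕ, a + n ≠ 0) {w : ℂ}
    (hw : w.re < 0) : HasDerivAt (lerchExp a S) (lerchExp a (S - 1) w) w := by
  have hq := norm_neg_exp_lt_one hw
  obtain ⟨d, hd, hs⟩ := hasDerivAt_tsum_mul_pow (fun q h => summable_norm_zpow_mul_pow a S h) hq
  have h1 : HasDerivAt (fun w => exp (a * w)) (exp (a * w) * (a * 1)) w :=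
    ((hasDerivAt_id w).const_mul a).cexp
  have h2 := h1.mul (hd.comp w (hasDerivAt_exp w).neg)
  refine h2.congr_deriv ?_
  have h3 := ((summable_norm_zpow_mul_pow a S hq).of_norm.hasSum.mul_left a).add hs
  have h4 : ∀ n : ℕ, a * (((a + n) ^ S)⁻¹ * (-exp w) ^ n) + n * (((a + n) ^ S)⁻¹ * (-exp w) ^ n) =
      ((a + n) ^ (S - 1))⁻¹ * (-exp w) ^ n := by
    intro n
    have : (a + n) * ((a + n) ^ S)⁻¹ = ((a + n) ^ (S - 1))⁻¹ := by
      rcases eq_or_ne (a + n) 0 with h | h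
      · have hS : S - 1 ≠ 0 := fun hS => ha (by lia) n h
        rw [h, zero_zpow _ hS]
        simp
      · rw [zpow_sub₀ h, zpow_one, inv_div, div_eq_mul_inv]
    rw [← this]
    ring
  simp only [h4] at h3
  rw [lerchExp, h3.tsum_eq]
  simp only [Function.comp, Pi.neg_apply]
  ring

theorem lerchExp_zero {a w : ℂ} (hw : w.re < 0) :
    lerchExp a 0 w = exp (a * w) / (1 + exp w) := by
  rw [lerchExp]
  simp only [zpow_zero, inv_one, one_mul]
  rw [tsum_geometric_of_norm_lt_one (norm_neg_exp_lt_one hw), sub_neg_eq_add, div_eq_mul_inv]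

/-! ### The cosecant generating function and its polynomials. -/

/-- The generating function of the coefficients `lerchCoeff`. -/
noncomputable def lerchCsc (a t : ℂ) : ℂ := I / 2 * (1 / sin (Real.pi * (t - a)))

theorem sin_pi_mul_ne_zero_of_ne_intCast {x : ℂ} (hx : ∀ k : ℤ, x ≠ k) :
    sin (Real.pi * x) ≠ 0 :=
  sin_pi_mul_ne_zero fun ⟨k, hk⟩ => hx k hk.symm

theorem differentiableAt_lerchCsc {a t : ℂ} (h : ∀ k : ℤ, t - a ≠ k) :
    DifferentiableAt ℂ (lerchCsc a) t := by
  have h1 := sin_pi_mul_ne_zero_of_ne_intCast h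
  unfold lerchCsc
  fun_prop (disch := assumption)

theorem contDiffAt_lerchCsc {a : ℂ} (ha : ∀ k : ℤ, a ≠ k) (n : ℕ) :
    ContDiffAt ℂ n (lerchCsc a) 0 := by
  have h1 : sin (Real.pi * (0 - a)) ≠ 0 := sin_pi_mul_ne_zero_of_ne_intCast fun k h => ha (-k) (by
    rw [Int.cast_neg, ← h]; ring)
  unfold lerchCsc
  refine contDiffAt_const.mul (contDiffAt_const.div ?_ h1)
  exact (contDiff_sin.comp (by fun_prop)).contDiffAt

theorem iteratedDeriv_exp_mul_const (n : ℕ) (w : ℂ) :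
    iteratedDeriv n (fun u : ℂ => exp (u * w)) 0 = w ^ n := by
  simp [mul_comm _ w]

/-- The `N`-th Taylor coefficient at `u = 0` of `e^{uw} (i/2) csc π(u - a)`. -/
noncomputable def lerchPoly (a : ℂ) (N : ℕ) (w : ℂ) : ℂ :=
  ∑ n ∈ Finset.range (N + 1), lerchCoeff a n * (w ^ (N - n) / ((N - n).factorial : ℂ))

theorem iteratedDeriv_exp_mul_lerchCsc {a : ℂ} (ha : ∀ k : ℤ, a ≠ k) (N : ℕ) (w : ℂ) :
    iteratedDeriv N (fun u => exp (u * w) * lerchCsc a u) 0 = N.factorial * lerchPoly a N w := by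
  have h1 : ContDiffAt ℂ N (fun u : ℂ => exp (u * w)) 0 := by fun_prop
  simp only [mul_comm (exp _)]
  rw [iteratedDeriv_fun_mul (contDiffAt_lerchCsc ha N) h1, lerchPoly, Finset.mul_sum]
  refine Finset.sum_congr rfl fun n hn => ?_
  have hn' : n ≤ N := Nat.lt_succ_iff.1 (Finset.mem_range.1 hn)
  rw [iteratedDeriv_exp_mul_const, ← Nat.choose_mul_factorial_mul_factorial hn', lerchCoeff,
    show (fun t : ℂ => I / 2 * (1 / sin (Real.pi * (t - a)))) = lerchCsc a from rfl]
  have h2 := Nat.factorial_ne_zero n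
  have h3 := Nat.factorial_ne_zero (N - n)
  push_cast
  field_simp

/-- For the generating function the combination is `2i sin π(u - a) · (i/2) csc π(u - a) = -1`,
constant in `u`. Only its zeroth Taylor coefficient survives. -/
theorem lerchPoly_boundary {a : ℂ} (ha : ∀ k : ℤ, a ≠ k) (N : ℕ) :
    exp (-(a * (Real.pi * I))) * lerchPoly a N (Real.pi * I) -
      exp (a * (Real.pi * I)) * lerchPoly a N (-(Real.pi * I)) = if N = 0 then -1 else 0 := by
  have h1 : ∀ w : ℂ, ContDiffAt ℂ N (fun u : ℂ => exp (u * w) * lerchCsc a u) 0 := fun w =>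
    ContDiffAt.mul (by fun_prop) (contDiffAt_lerchCsc ha N)
  have h2 : (fun u => exp (-(a * (Real.pi * I))) * (exp (u * (Real.pi * I)) * lerchCsc a u) -
      exp (a * (Real.pi * I)) * (exp (u * -(Real.pi * I)) * lerchCsc a u)) =ᶠ[nhds 0]
      fun _ => -1 := by
    have h3 : ∀ᶠ u in nhds (0 : ℂ), sin (Real.pi * (u - a)) ≠ 0 := by
      have : ContinuousAt (fun u : ℂ => sin (Real.pi * (u - a))) 0 := by fun_prop
      refine this.eventually_ne (sin_pi_mul_ne_zero_of_ne_intCast fun k h => ha (-k) (by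
        rw [Int.cast_neg, ← h]; ring))
    filter_upwards [h3] with u hu
    have h4 : exp (-(a * (Real.pi * I))) * exp (u * (Real.pi * I)) -
        exp (a * (Real.pi * I)) * exp (u * -(Real.pi * I)) =
        2 * I * sin (Real.pi * (u - a)) := by
      rw [← exp_add, ← exp_add, sin]
      ring_nf
      rw [I_sq]
      ring
    calc _ = (exp (-(a * (Real.pi * I))) * exp (u * (Real.pi * I)) -
        exp (a * (Real.pi * I)) * exp (u * -(Real.pi * I))) * lerchCsc a u := by ring
      _ = I * I * (sin (Real.pi * (u - a)) * (sin (Real.pi * (u - a)))⁻¹) := by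
        rw [h4, lerchCsc]; ring
      _ = -1 := by rw [mul_inv_cancel₀ hu, I_mul_I, mul_one]
  have h5 := h2.iteratedDeriv_eq N
  rw [iteratedDeriv_fun_sub (contDiffAt_const.mul (h1 _)) (contDiffAt_const.mul (h1 _)),
    iteratedDeriv_const_mul_field, iteratedDeriv_const_mul_field,
    iteratedDeriv_exp_mul_lerchCsc ha, iteratedDeriv_exp_mul_lerchCsc ha, iteratedDeriv_const] at h5
  have h6 : (N.factorial : ℂ) ≠ 0 := by exact_mod_cast Nat.factorial_ne_zero N
  refine mul_left_cancel₀ h6 (Eq.trans (by ring) (h5.trans ?_))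
  split_ifs with h <;> simp [h]

theorem hasDerivAt_lerchPoly_succ (a : ℂ) (N : ℕ) (w : ℂ) :
    HasDerivAt (lerchPoly a (N + 1)) (lerchPoly a N w) w := by
  unfold lerchPoly
  simp only [Finset.sum_range_succ _ (N + 1), Nat.sub_self, pow_zero]
  refine (HasDerivAt.fun_sum fun n hn => ?_).add_const _
  have hn' : n ≤ N := Nat.lt_succ_iff.1 (Finset.mem_range.1 hn)
  rw [Nat.succ_sub hn']
  refine HasDerivAt.const_mul _ (((hasDerivAt_pow _ w).div_const _).congr_deriv ?_)
  have h2 : (((N - n).succ : ℕ) : ℂ) ≠ 0 := by exact_mod_cast Nat.succ_ne_zero (N - n)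
  rw [Nat.factorial_succ, Nat.cast_mul, mul_div_mul_left _ _ h2]
  simp

theorem lerchPoly_zero (a w : ℂ) : lerchPoly a 0 w = lerchCoeff a 0 := by
  simp [lerchPoly]

/-! ### The strip and the jump between its corner points. -/

/-- The image of the plane cut along `[0, ∞)` under `z ↦ log (-z)`. -/
def logStrip : Set ℂ := im ⁻¹' Ioo (-Real.pi) Real.pi

theorem isOpen_logStrip : IsOpen logStrip := isOpen_Ioo.preimage continuous_im

theorem convex_logStrip : Convex ℝ logStrip := (convex_Ioo _ _).linear_preimage imLm

theorem exp_mem_slitPlane_of_mem_logStrip {w : ℂ} (hw : w ∈ logStrip) : exp w ∈ slitPlane := by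
  rw [mem_slitPlane_iff_arg]
  refine ⟨?_, exp_ne_zero w⟩
  rw [arg_exp, (toIocMod_eq_self _).2]
  · exact hw.2.ne
  · rw [two_mul, neg_add_cancel_left]
    exact ⟨hw.1, hw.2.le⟩

theorem one_add_exp_ne_zero {w : ℂ} (hw : w ∈ logStrip) : 1 + exp w ≠ 0 := by
  intro h
  have h1 := exp_mem_slitPlane_of_mem_logStrip hw
  rw [eq_neg_of_add_eq_zero_right h] at h1
  simp [slitPlane] at h1
  linarith

theorem one_add_exp_mul_I_mem_slitPlane {y : ℝ} (hy : y ∈ Ioo (-Real.pi) Real.pi) :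
    1 + exp (y * I) ∈ slitPlane := by
  have hc : 0 < Real.cos (y / 2) := Real.cos_pos_of_mem_Ioo ⟨by linarith [hy.1], by linarith [hy.2]⟩
  refine Or.inl ?_
  have : Real.cos y = 2 * Real.cos (y / 2) ^ 2 - 1 := by
    rw [← Real.cos_two_mul]; ring_nf
  rw [add_re, one_re, exp_ofReal_mul_I_re, this]
  nlinarith [sq_pos_of_pos hc]

/-- Half-angle factorization `1 + e^{iy} = 2 cos(y/2) e^{iy/2}`. Hence the logarithms at `y` and
`-y` differ by exactly `iy`. -/
theorem log_one_add_exp_mul_I {y : ℝ} (hy : y ∈ Ioo (-Real.pi) Real.pi) :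
    log (1 + exp (y * I)) = Real.log (2 * Real.cos (y / 2)) + (y / 2 : ℝ) * I := by
  have hc : 0 < Real.cos (y / 2) := Real.cos_pos_of_mem_Ioo ⟨by linarith [hy.1], by linarith [hy.2]⟩
  have h1 : 1 + exp (y * I) = (2 * Real.cos (y / 2) : ℝ) * exp ((y / 2 : ℝ) * I) := by
    rw [ofReal_mul, ofReal_cos, ofReal_ofNat, two_cos, add_mul, ← exp_add, ← exp_add]
    push_cast
    ring_nf
    rw [exp_zero]
    ring
  rw [h1, log_ofReal_mul (by positivity) (exp_ne_zero _), log_exp]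
  · simp; linarith [hy.1, Real.pi_pos]
  · simp; linarith [hy.2, Real.pi_pos]

open Filter Topology in
theorem tendsto_ofReal_add_nhdsWithin {s : Set ℝ} (c : ℂ) :
    Tendsto (fun x : ℝ => (x : ℂ) + c) (𝓝[s] 0) (𝓝 c) := by
  have : Continuous fun x : ℝ => (x : ℂ) + c := by fun_prop
  simpa using (this.tendsto 0).mono_left nhdsWithin_le_nhds

open Filter Topology Metric in
/-- If a function on the strip is, up to a logarithmic term, given on its two halves by continuous
functions of `-e^w` and of `-e^{-w}`, then the jump of `e^{-aw} P(w)` between the endpoints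
`-πi` and `πi` is that of the logarithmic term. -/
theorem boundary_jump {a l : ℂ} {P Hm Hp Psi : ℂ → ℂ} (hP : Continuous P)
    (hm : ContinuousOn Hm (closedBall 0 1)) (hp : ContinuousOn Hp (closedBall 0 1))
    (hPsi : ContinuousOn Psi logStrip)
    (left : ∀ w ∈ logStrip, w.re < 0 →
      Psi w = exp (a * w) * (Hm (-exp w) + l * log (1 + exp w)))
    (right : ∀ w ∈ logStrip, 0 < w.re →
      Psi w = P w + exp (a * w) * (Hp (-exp (-w)) + l * log (1 + exp (-w)))) :
    exp (-(a * (Real.pi * I))) * P (Real.pi * I) -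
      exp (a * (Real.pi * I)) * P (-(Real.pi * I)) = 2 * Real.pi * I * l := by
  -- `H` is controlled only on the closed disk, so the limit at `iy` is taken along points with
  -- negative real part, where `-e^f` lies inside.
  have cont : ∀ {H : ℂ → ℂ}, ContinuousOn H (closedBall 0 1) → ∀ {y : ℝ} {f : ℝ → ℂ} {s : Set ℝ},
      y ∈ Ioo (-Real.pi) Real.pi → Tendsto f (𝓝[s] 0) (𝓝 (y * I)) →
      (∀ᶠ x in 𝓝[s] 0, (f x).re < 0) →
      Tendsto (fun x => H (-exp (f x)) + l * log (1 + exp (f x))) (𝓝[s] 0)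
        (𝓝 (H (-exp (y * I)) + l * log (1 + exp (y * I)))) := by
    intro H hH y f s hy hf hneg
    have h1 : Tendsto (fun x => exp (f x)) (𝓝[s] 0) (𝓝 (exp (y * I))) := hf.cexp
    refine Tendsto.add (Tendsto.comp (hH (-exp (y * I)) (by simp [norm_exp])) ?_)
      (((h1.const_add 1).clog (one_add_exp_mul_I_mem_slitPlane hy)).const_mul l)
    refine tendsto_nhdsWithin_iff.2 ⟨h1.neg, ?_⟩
    filter_upwards [hneg] with x hx
    simpa using (norm_neg_exp_lt_one hx).le
  -- The limits of `Psi` from both halves agree at `iy`. The logarithms combine into `l · iy`, which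
  -- stays continuous up to `y = ±π`, unlike each of them separately.
  have key : ∀ y ∈ Ioo (-Real.pi) Real.pi, Hm (-exp (y * I)) - Hp (-exp (-(y * I))) + l * (y * I) =
      exp (-(a * (y * I))) * P (y * I) := by
    intro y hy
    have hmem : ∀ x : ℝ, (x : ℂ) + y * I ∈ logStrip := fun x => by simpa [logStrip] using hy
    have hy' : -y ∈ Ioo (-Real.pi) Real.pi := ⟨by linarith [hy.2], by linarith [hy.1]⟩
    have hPsi' : ContinuousAt Psi (y * I) :=
      hPsi.continuousAt (isOpen_logStrip.mem_nhds (by simpa using hmem 0))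
    have e1 : Tendsto (fun x : ℝ => exp (a * ((x : ℂ) + y * I))) (𝓝[<] 0) (𝓝 (exp (a * (y * I)))) :=
      ((tendsto_ofReal_add_nhdsWithin _).const_mul a).cexp
    have e2 : Tendsto (fun x : ℝ => exp (a * ((x : ℂ) + y * I))) (𝓝[>] 0) (𝓝 (exp (a * (y * I)))) :=
      ((tendsto_ofReal_add_nhdsWithin _).const_mul a).cexp
    have h1 : Psi (y * I) =
        exp (a * (y * I)) * (Hm (-exp (y * I)) + l * log (1 + exp (y * I))) := by
      refine tendsto_nhds_unique (hPsi'.tendsto.comp (tendsto_ofReal_add_nhdsWithin (s := Iio 0) _))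
        ((e1.mul (cont hm hy (tendsto_ofReal_add_nhdsWithin _) ?_)).congr' ?_)
      · filter_upwards [self_mem_nhdsWithin] with x hx
        simpa using hx
      · filter_upwards [self_mem_nhdsWithin] with x hx
        exact (left _ (hmem x) (by simpa using hx)).symm
    have h2 : Psi (y * I) = P (y * I) +
        exp (a * (y * I)) * (Hp (-exp ((-y : ℝ) * I)) + l * log (1 + exp ((-y : ℝ) * I))) := by
      refine tendsto_nhds_unique (hPsi'.tendsto.comp (tendsto_ofReal_add_nhdsWithin (s := Ioi 0) _))
        (((hP.continuousAt.tendsto.comp (tendsto_ofReal_add_nhdsWithin _)).add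
          (e2.mul (cont hp hy' (f := fun x => -((x : ℂ) + y * I)) ?_ ?_))).congr' ?_)
      · simpa using (tendsto_ofReal_add_nhdsWithin (s := Ioi 0) (y * I)).neg
      · filter_upwards [self_mem_nhdsWithin] with x hx
        simpa using hx
      · filter_upwards [self_mem_nhdsWithin] with x hx
        exact (right _ (hmem x) (by simpa using hx)).symm
    rw [log_one_add_exp_mul_I hy] at h1
    rw [log_one_add_exp_mul_I hy', neg_div, Real.cos_neg, ofReal_neg, neg_mul] at h2
    have h3 : exp (-(a * (y * I))) * exp (a * (y * I)) = 1 := by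
      rw [← exp_add, neg_add_cancel, exp_zero]
    have h4 := h1.symm.trans h2
    push_cast at h4
    linear_combination exp (-(a * (y * I))) * h4 - (Hm (-exp (y * I)) - Hp (-exp (-(y * I))) +
      l * (y * I)) * h3
  have hcm : Continuous fun y : ℝ => Hm (-exp (y * I)) :=
    hm.comp_continuous (by fun_prop) fun y => by simp [norm_exp]
  have hcp : Continuous fun y : ℝ => Hp (-exp (-(y * I))) :=
    hp.comp_continuous (by fun_prop) fun y => by simp [norm_exp]
  have key' := EqOn.closure key ((hcm.sub hcp).add (by fun_prop)) (by fun_prop)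
  rw [closure_Ioo (by linarith [Real.pi_pos])] at key'
  have k1 := key' (right_mem_Icc.2 (by linarith [Real.pi_pos]))
  have k2 := key' (left_mem_Icc.2 (by linarith [Real.pi_pos]))
  -- At both endpoints the arguments become `1`, so `Hm 1 - Hp 1` drops out of the difference.
  simp only [ofReal_neg, neg_mul, mul_neg, neg_neg, exp_neg_pi_mul_I, exp_pi_mul_I] at k1 k2
  linear_combination k2 - k1

/-! ### Strip continuations: differentiation and integration in `w`. -/

theorem ne_intCast_one_sub {a : ℂ} (ha : ∀ k : ℤ, a ≠ k) (k : ℤ) : 1 - a ≠ k := fun h =>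
  ha (1 - k) (by rw [Int.cast_sub, ← h]; simp)

theorem add_natCast_ne_zero {a : ℂ} (ha : ∀ k : ℤ, a ≠ k) (n : ℕ) : a + n ≠ 0 := fun h =>
  ha (-n) (by push_cast; exact eq_neg_of_add_eq_zero_left h)

theorem hasDerivAt_lerchExp_reflect {a : ℂ} {S : ℤ} (ha : S = 1 → ∀ n : ℕ, 1 - a + n ≠ 0) {w : ℂ}
    (hw : 0 < w.re) : HasDerivAt (fun w => (-1) ^ S * lerchExp (1 - a) S (-w))
      ((-1) ^ (S - 1) * lerchExp (1 - a) (S - 1) (-w)) w := by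
  have h1 := ((hasDerivAt_lerchExp ha (w := -w) (by simpa using hw)).comp w
    (hasDerivAt_neg w)).const_mul ((-1 : ℂ) ^ S)
  refine h1.congr_deriv ?_
  rw [zpow_sub₀ (by norm_num), zpow_one]
  ring

/-- `F` is a continuation of `e^{aw} Φ(-e^w, S, a)` to the strip whose form on the right half is
`P(w)` plus the reflected series. -/
structure IsStripContinuation (a : ℂ) (S : ℤ) (P F : ℂ → ℂ) : Prop where
  differentiableOn : DifferentiableOn ℂ F logStrip
  left : ∀ w ∈ logStrip, w.re < 0 → F w = lerchExp a S w
  right : ∀ w ∈ logStrip, 0 < w.re → F w = P w + (-1) ^ S * lerchExp (1 - a) S (-w)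

/-- The symmetry of `e^{aw} / (1 + e^w)` under `(a, w) ↦ (1 - a, -w)` is what makes the extra term
zero. -/
theorem isStripContinuation_zero (a : ℂ) :
    IsStripContinuation a 0 0 (fun w => exp (a * w) / (1 + exp w)) where
  differentiableOn := by
    intro w hw
    have := one_add_exp_ne_zero hw
    exact DifferentiableAt.differentiableWithinAt (by fun_prop (disch := assumption))
  left w _ hw := (lerchExp_zero hw).symm
  right w h hw := by
    rw [lerchExp_zero (by simpa using hw)]
    have h1 := one_add_exp_ne_zero h
    have h2 : 1 + exp (-w) = (1 + exp w) * exp (-w) := by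
      rw [add_mul, ← exp_add, add_neg_cancel, exp_zero, one_mul, add_comm]
    have h3 : exp ((1 - a) * -w) = exp (a * w) * exp (-w) := by
      rw [← exp_add]; ring_nf
    rw [h2, h3, mul_div_mul_right _ _ (exp_ne_zero _)]
    simp

/-- Descending from `S ≤ 0` never meets the exceptional order `1`, so integer `a` is allowed. -/
theorem IsStripContinuation.deriv {a : ℂ} {S : ℤ} {F : ℂ → ℂ} (hS : S ≤ 0)
    (h : IsStripContinuation a S 0 F) : IsStripContinuation a (S - 1) 0 (deriv F) where
  differentiableOn := h.differentiableOn.deriv isOpen_logStrip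
  left w hw hr := by
    rw [← (hasDerivAt_lerchExp (fun h => by lia) hr).deriv]
    refine Filter.EventuallyEq.deriv_eq ?_
    filter_upwards [isOpen_logStrip.mem_nhds hw,
      (isOpen_Iio.preimage continuous_re).mem_nhds hr] with x hx hx' using h.left x hx hx'
  right w hw hr := by
    rw [Pi.zero_apply, zero_add, ← (hasDerivAt_lerchExp_reflect (fun h => by lia) hr).deriv]
    refine Filter.EventuallyEq.deriv_eq ?_
    filter_upwards [isOpen_logStrip.mem_nhds hw,
      (isOpen_Ioi.preimage continuous_re).mem_nhds hr] with x hx hx'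
    simpa using h.right x hx hx'

theorem exists_isStripContinuation_of_nonpos (a : ℂ) (m : ℕ) :
    ∃ F, IsStripContinuation a (-m) 0 F := by
  induction m with
  | zero => exact ⟨_, by simpa using isStripContinuation_zero a⟩
  | succ m ih =>
    obtain ⟨F, hF⟩ := ih
    have := hF.deriv (by lia)
    rw [show (-(m : ℤ) - 1) = -((m + 1 : ℕ) : ℤ) by push_cast; ring] at this
    exact ⟨_, this⟩

theorem exists_eq_add_const_of_hasDerivAt {s : Set ℂ} (hs : IsOpen s) (hc : Convex ℝ s)
    {f g d : ℂ → ℂ} (hf : ∀ w ∈ s, HasDerivAt f (d w) w) (hg : ∀ w ∈ s, HasDerivAt g (d w) w) :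
    ∃ c, ∀ w ∈ s, f w = g w + c :=
  hs.exists_eq_add_of_deriv_eq hc.isPreconnected
    (fun w hw => (hf w hw).differentiableAt.differentiableWithinAt)
    (fun w hw => (hg w hw).differentiableAt.differentiableWithinAt)
    (fun w hw => (hf w hw).deriv.trans (hg w hw).deriv.symm)

/-- Integration of a strip continuation determines the next one up to a constant on the right. -/
theorem IsStripContinuation.exists_primitive {a : ℂ} (ha : ∀ k : ℤ, a ≠ k) {S : ℤ} {P Q F : ℂ → ℂ}
    (h : IsStripContinuation a (S - 1) P F) (hQ : ∀ w, HasDerivAt Q (P w) w) :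
    ∃ G c, IsStripContinuation a S (fun w => Q w + c) G := by
  obtain ⟨G, hG⟩ := convex_logStrip.exists_forall_hasDerivWithinAt h.differentiableOn
  have hG' : ∀ w ∈ logStrip, HasDerivAt G (F w) w := fun w hw =>
    (hG w hw).hasDerivAt (isOpen_logStrip.mem_nhds hw)
  have hoL := isOpen_logStrip.inter (isOpen_Iio.preimage continuous_re : IsOpen (re ⁻¹' Iio 0))
  have hcL := convex_logStrip.inter ((convex_Iio (0 : ℝ)).linear_preimage reLm)
  have hoR := isOpen_logStrip.inter (isOpen_Ioi.preimage continuous_re : IsOpen (re ⁻¹' Ioi 0))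
  have hcR := convex_logStrip.inter ((convex_Ioi (0 : ℝ)).linear_preimage reLm)
  obtain ⟨c₁, hc₁⟩ := exists_eq_add_const_of_hasDerivAt hoL hcL (f := G) (g := lerchExp a S)
    (d := lerchExp a (S - 1)) (fun w hw => by
      rw [← h.left w hw.1 hw.2]
      exact hG' w hw.1)
    (fun w hw => hasDerivAt_lerchExp (fun _ => add_natCast_ne_zero ha) hw.2)
  obtain ⟨c₂, hc₂⟩ := exists_eq_add_const_of_hasDerivAt hoR hcR (f := G)
    (g := fun w => Q w + (-1) ^ S * lerchExp (1 - a) S (-w))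
    (d := fun w => P w + (-1) ^ (S - 1) * lerchExp (1 - a) (S - 1) (-w)) (fun w hw => by
      rw [← h.right w hw.1 hw.2]
      exact hG' w hw.1)
    (fun w hw => (hQ w).add (hasDerivAt_lerchExp_reflect
      (fun _ => add_natCast_ne_zero (ne_intCast_one_sub ha)) hw.2))
  -- Normalizing the primitive by the series on the left pushes the whole ambiguity to the right
  -- half.
  refine ⟨fun w => G w - c₁, c₂ - c₁, ⟨?_, ?_, ?_⟩⟩
  · exact fun w hw => ((hG' w hw).differentiableAt.sub_const _).differentiableWithinAt
  · intro w hw hr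
    rw [hc₁ w ⟨hw, hr⟩]
    ring
  · intro w hw hr
    rw [hc₂ w ⟨hw, hr⟩]
    ring

/-! ### Vanishing of the constant of integration. -/

open Metric in
theorem continuousOn_tsum_mul_pow {c : ℕ → ℂ} (hc : Summable fun n => ‖c n‖) :
    ContinuousOn (fun q : ℂ => ∑' n, c n * q ^ n) (closedBall 0 1) := by
  refine continuousOn_tsum (fun n => by fun_prop) hc fun n q hq => ?_
  rw [norm_mul, norm_pow]
  exact mul_le_of_le_one_right (norm_nonneg _)
    (pow_le_one₀ (norm_nonneg _) (by simpa using hq))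

/-- The value of `e^{-aw}` times the reflected series in terms of `e^{-w}`. -/
theorem lerchExp_reflect (a : ℂ) (S : ℤ) (w : ℂ) : lerchExp (1 - a) S (-w) =
    exp (a * w) * -(-exp (-w) * ∑' n : ℕ, ((1 - a + n) ^ S)⁻¹ * (-exp (-w)) ^ n) := by
  have h3 : exp ((1 - a) * -w) = exp (a * w) * exp (-w) := by
    rw [← exp_add]; ring_nf
  rw [lerchExp, h3]
  ring

/-- The factor of `c` is `-2i sin πa`, nonzero for non-integer `a`. -/
theorem eq_zero_of_exp_mul_eq {a c : ℂ} (ha : ∀ k : ℤ, a ≠ k)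
    (h : exp (-(a * (Real.pi * I))) * c - exp (a * (Real.pi * I)) * c = 0) : c = 0 := by
  have h1 : (exp (-(a * (Real.pi * I))) - exp (a * (Real.pi * I))) * I = 2 * sin (Real.pi * a) := by
    rw [sin]
    ring_nf
  have h2 := sin_pi_mul_ne_zero_of_ne_intCast ha
  have h3 : (2 * sin (Real.pi * a)) * c = 0 := by
    rw [← h1]
    linear_combination I * h
  simpa [h2] using h3

theorem continuous_lerchPoly (a : ℂ) (N : ℕ) : Continuous (lerchPoly a N) := by
  unfold lerchPoly
  fun_prop

-- From order `2` on the coefficients are absolutely summable, so both series are continuous on the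
-- closed disk and the jump is taken with `l = 0`.
open Metric in
theorem const_eq_zero_of_two_le {a c : ℂ} (ha : ∀ k : ℤ, a ≠ k) {N : ℕ} (hN : 1 ≤ N) {F : ℂ → ℂ}
    (h : IsStripContinuation a (N + 1)
      (fun w => 2 * Real.pi * I * lerchPoly a N w + c) F) : c = 0 := by
  have hS : (2 : ℤ) ≤ N + 1 := by lia
  have := boundary_jump (a := a) (l := 0)
    (P := fun w => 2 * Real.pi * I * lerchPoly a N w + c)
    (Hm := fun q => ∑' n : ℕ, ((a + n) ^ (N + 1 : ℤ))⁻¹ * q ^ n)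
    (Hp := fun q => (-1) ^ (N + 1 : ℤ) *
      -(q * ∑' n : ℕ, ((1 - a + n) ^ (N + 1 : ℤ))⁻¹ * q ^ n)) (Psi := F)
    ((continuous_const.mul (continuous_lerchPoly a N)).add continuous_const)
    (continuousOn_tsum_mul_pow (summable_norm_inv_add_zpow hS a))
    ((continuousOn_id.mul
      (continuousOn_tsum_mul_pow (summable_norm_inv_add_zpow hS (1 - a)))).neg.const_mul _)
    h.differentiableOn.continuousOn
    (fun w hw hr => by rw [h.left w hw hr, lerchExp, zero_mul, add_zero])
    (fun w hw hr => by rw [h.right w hw hr, lerchExp_reflect]; ring)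
  have h2 := lerchPoly_boundary ha N
  rw [if_neg (by lia)] at h2
  refine eq_zero_of_exp_mul_eq ha ?_
  linear_combination this - 2 * Real.pi * I * h2

theorem tsum_inv_add_mul_pow (a b : ℂ) {q : ℂ} (hq : ‖q‖ < 1) :
    ∑' n : ℕ, ((a + n) ^ (1 : ℤ))⁻¹ * q ^ n =
      (∑' n : ℕ, ((a + n)⁻¹ - (b + n)⁻¹) * q ^ n) + ∑' n : ℕ, (b + n)⁻¹ * q ^ n := by
  have h1 := (summable_norm_zpow_mul_pow a 1 hq).of_norm
  have h2 := (summable_norm_zpow_mul_pow b 1 hq).of_norm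
  simp only [zpow_one] at h1 h2 ⊢
  simp only [sub_mul]
  rw [h1.tsum_sub h2, sub_add_cancel]

/-- The term `n = 0` is zero by the convention `0⁻¹ = 0`. -/
theorem tsum_inv_natCast_mul_pow {q : ℂ} (hq : ‖q‖ < 1) :
    ∑' n : ℕ, (0 + n : ℂ)⁻¹ * q ^ n = -log (1 - q) := by
  rw [← (hasSum_taylorSeries_neg_log hq).tsum_eq]
  refine tsum_congr fun n => ?_
  rw [zero_add, div_eq_inv_mul]

theorem mul_tsum_inv_one_add_natCast_mul_pow {q : ℂ} (hq : ‖q‖ < 1) :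
    q * ∑' n : ℕ, (1 + n : ℂ)⁻¹ * q ^ n = -log (1 - q) := by
  have h := (hasSum_nat_add_iff' 1).2 (hasSum_taylorSeries_neg_log hq)
  simp only [Finset.sum_range_one, Nat.cast_zero, div_zero, sub_zero] at h
  rw [← h.tsum_eq, ← tsum_mul_left]
  refine tsum_congr fun n => ?_
  rw [pow_succ, Nat.cast_add, Nat.cast_one, div_eq_inv_mul, add_comm (n : ℂ)]
  ring

-- At order `1` the series diverge logarithmically at `q = 1`. Subtracting the coefficients `1/n` on
-- the left and `1/(n+1)` on the right leaves absolutely summable remainders and the same multiple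
-- `l = -1` of the logarithm on both sides.
open Metric in
theorem const_eq_zero_of_eq_one {a c : ℂ} (ha : ∀ k : ℤ, a ≠ k) {F : ℂ → ℂ}
    (h : IsStripContinuation a 1 (fun w => 2 * Real.pi * I * lerchPoly a 0 w + c) F) : c = 0 := by
  have := boundary_jump (a := a) (l := -1)
    (P := fun w => 2 * Real.pi * I * lerchPoly a 0 w + c)
    (Hm := fun q => ∑' n : ℕ, ((a + n)⁻¹ - ((0 : ℂ) + n)⁻¹) * q ^ n)
    (Hp := fun q => q * ∑' n : ℕ, ((1 - a + n)⁻¹ - ((1 : ℂ) + n)⁻¹) * q ^ n) (Psi := F)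
    ((continuous_const.mul (continuous_lerchPoly a 0)).add continuous_const)
    (continuousOn_tsum_mul_pow (summable_norm_inv_sub_inv a 0))
    (continuousOn_id.mul
      (continuousOn_tsum_mul_pow (summable_norm_inv_sub_inv (1 - a) 1)))
    h.differentiableOn.continuousOn
    (fun w hw hr => by
      have hq := norm_neg_exp_lt_one hr
      rw [h.left w hw hr, lerchExp, tsum_inv_add_mul_pow a 0 hq, tsum_inv_natCast_mul_pow hq,
        sub_neg_eq_add, neg_one_mul])
    (fun w hw hr => by
      have hq := norm_neg_exp_lt_one (w := -w) (by simpa using hr)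
      rw [h.right w hw hr, lerchExp_reflect, tsum_inv_add_mul_pow (1 - a) 1 hq, mul_add,
        mul_tsum_inv_one_add_natCast_mul_pow hq, zpow_one]
      ring_nf)
  have h2 := lerchPoly_boundary ha 0
  rw [if_pos rfl] at h2
  refine eq_zero_of_exp_mul_eq ha ?_
  linear_combination this - 2 * Real.pi * I * h2

theorem exists_isStripContinuation_of_pos {a : ℂ} (ha : ∀ k : ℤ, a ≠ k) (N : ℕ) :
    ∃ F, IsStripContinuation a (N + 1) (fun w => 2 * Real.pi * I * lerchPoly a N w) F := by
  induction N with
  | zero =>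
    obtain ⟨G, c, hG⟩ := IsStripContinuation.exists_primitive (S := 1) ha
      (isStripContinuation_zero a) (Q := fun w => 2 * Real.pi * I * lerchPoly a 0 w) (fun w => by
        simp only [lerchPoly_zero, Pi.zero_apply]
        exact hasDerivAt_const w _)
    have hc := const_eq_zero_of_eq_one ha hG
    subst hc
    exact ⟨G, by simpa using hG⟩
  | succ N ih =>
    obtain ⟨F, hF⟩ := ih
    rw [← add_sub_cancel_right ((N : ℤ) + 1) 1] at hF
    obtain ⟨G, c, hG⟩ := hF.exists_primitive ha
      (fun w => (hasDerivAt_lerchPoly_succ a N w).const_mul (2 * Real.pi * I))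
    have hG' : IsStripContinuation a ((N + 1 : ℕ) + 1)
      (fun w => 2 * Real.pi * I * lerchPoly a (N + 1) w + c) G := by exact_mod_cast hG
    have hc := const_eq_zero_of_two_le ha (by lia) hG'
    subst hc
    exact ⟨G, by simpa using hG'⟩

/-! ### From the strip to the cut plane. -/

theorem isOpen_lerchDomain : IsOpen lerchDomain :=
  isOpen_slitPlane.preimage (by fun_prop : Continuous fun z : ℂ => 1 - z)

theorem isPreconnected_lerchDomain : IsPreconnected lerchDomain := by
  have h : lerchDomain = (fun z : ℂ => 1 - z) '' slitPlane := by
    ext z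
    exact ⟨fun h => ⟨1 - z, h, by simp⟩, by rintro ⟨w, hw, rfl⟩; simpa [lerchDomain] using hw⟩
  rw [h]
  exact (starConvex_one_slitPlane.isPathConnected
    one_mem_slitPlane).isConnected.isPreconnected.image _ (by fun_prop)

theorem ball_subset_lerchDomain {z : ℂ} (hz : ‖z‖ < 1) : z ∈ lerchDomain := by
  rw [lerchDomain, mem_ofPred_eq, sub_eq_add_neg]
  exact mem_slitPlane_of_norm_lt_one (by simpa using hz)

theorem IsLerchContinuation.eqOn {s a : ℂ} {F G : ℂ → ℂ} (hF : IsLerchContinuation s a F)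
    (hG : IsLerchContinuation s a G) : EqOn F G lerchDomain := by
  refine (hF.1.analyticOnNhd isOpen_lerchDomain).eqOn_of_preconnected_of_eventuallyEq
    (hG.1.analyticOnNhd isOpen_lerchDomain) isPreconnected_lerchDomain
    (ball_subset_lerchDomain (z := 0) (by simp)) ?_
  filter_upwards [Metric.ball_mem_nhds (0 : ℂ) one_pos] with z hz
  have hz' : ‖z‖ < 1 := by simpa using hz
  exact (hF.2 z hz').unique (hG.2 z hz')

theorem IsLerchContinuation.isLerchContinuation_lerchPhi {s a : ℂ} {F : ℂ → ℂ}
    (hF : IsLerchContinuation s a F) : IsLerchContinuation s a (fun z => lerchPhi z s a) := by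
  have h : ∃ F, IsLerchContinuation s a F := ⟨F, hF⟩
  have h2 : (fun z => lerchPhi z s a) = h.choose := by
    ext z
    rw [lerchPhi, dif_pos h]
  rw [h2]
  exact h.choose_spec

theorem neg_mem_slitPlane_of_one_le_norm {z : ℂ} (hz : z ∈ lerchDomain) (h1 : 1 ≤ ‖z‖) :
    -z ∈ slitPlane := by
  by_contra h
  have hz' : ¬ (1 - z).re ≤ 0 ∨ (1 - z).im ≠ 0 := by
    rcases hz with h | h
    · exact Or.inl (not_le.2 h)
    · exact Or.inr h
  rw [mem_slitPlane_iff, not_or, neg_re, neg_im, not_lt, not_not, neg_eq_zero] at h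
  have h3 : z = (z.re : ℂ) := Complex.ext rfl (by simpa using h.2)
  rw [h3, norm_real, Real.norm_of_nonneg (by linarith [h.1])] at h1
  simp [h.2] at hz'
  linarith

theorem log_mem_logStrip {z : ℂ} (hz : z ∈ slitPlane) : log z ∈ logStrip := by
  rw [logStrip, mem_preimage, log_im]
  exact ⟨neg_pi_lt_arg z, lt_of_le_of_ne (arg_le_pi z) (mem_slitPlane_iff_arg.1 hz).1⟩

open Classical in
/-- The continuation to the cut plane assembled from the series and from a strip continuation. -/
noncomputable def lerchGlue (a : ℂ) (S : ℤ) (Psi : ℂ → ℂ) (z : ℂ) : ℂ :=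
  if ‖z‖ < 1 then ∑' n : ℕ, ((a + n) ^ S)⁻¹ * z ^ n else exp (-(a * log (-z))) * Psi (log (-z))

/-- The two branches agree off `[0, ∞)`, so the strip formula holds in a full neighbourhood of each
point of the cut plane with `‖z‖ ≥ 1`. -/
theorem IsStripContinuation.lerchGlue_eq {a : ℂ} {S : ℤ} {P Psi : ℂ → ℂ}
    (h : IsStripContinuation a S P Psi) {z : ℂ} (hz : -z ∈ slitPlane) :
    lerchGlue a S Psi z = exp (-(a * log (-z))) * Psi (log (-z)) := by
  rw [lerchGlue]
  split_ifs with h1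
  · have h0 : z ≠ 0 := by simpa using slitPlane_ne_zero hz
    rw [h.left _ (log_mem_logStrip hz) (by
      rw [log_re, norm_neg]; exact Real.log_neg (norm_pos_iff.2 h0) h1),
      lerchExp, exp_log (neg_ne_zero.2 h0), ← mul_assoc, ← exp_add, neg_add_cancel, exp_zero,
      one_mul, neg_neg]
  · rfl

theorem IsStripContinuation.isLerchContinuation {a : ℂ} {S : ℤ} {P Psi : ℂ → ℂ}
    (h : IsStripContinuation a S P Psi) : IsLerchContinuation S a (lerchGlue a S Psi) := by
  refine ⟨fun z hz => DifferentiableAt.differentiableWithinAt ?_, fun z hz => ?_⟩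
  · rcases lt_or_ge ‖z‖ 1 with h1 | h1
    · obtain ⟨d, hd, -⟩ := hasDerivAt_tsum_mul_pow (fun q h => summable_norm_zpow_mul_pow a S h) h1
      refine hd.differentiableAt.congr_of_eventuallyEq ?_
      filter_upwards [Metric.isOpen_ball.mem_nhds (mem_ball_zero_iff.2 h1)] with w hw
      rw [lerchGlue, if_pos (mem_ball_zero_iff.1 hw)]
    · have hz' := neg_mem_slitPlane_of_one_le_norm hz h1
      have hl : DifferentiableAt ℂ (fun z => log (-z)) z := differentiableAt_id.neg.clog hz'
      have hP : DifferentiableAt ℂ Psi (log (-z)) :=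
        h.differentiableOn.differentiableAt (isOpen_logStrip.mem_nhds (log_mem_logStrip hz'))
      refine DifferentiableAt.congr_of_eventuallyEq
        ((hl.const_mul a).neg.cexp.mul (hP.comp z hl)) ?_
      filter_upwards [(isOpen_slitPlane.preimage continuous_neg).mem_nhds hz'] with w hw
      exact h.lerchGlue_eq hw
  · have h1 := (summable_norm_zpow_mul_pow a S hz).of_norm.hasSum
    rw [lerchGlue, if_pos hz]
    refine h1.congr_fun fun n => ?_
    rw [cpow_intCast, div_eq_inv_mul]

theorem one_div_pow_div_zpow_eq (a z : ℂ) (S : ℤ) (n : ℕ) :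
    (1 / z ^ (n + 1)) / (((n + 1 : ℕ) : ℂ) - a) ^ S =
      z⁻¹ * (((1 - a + n) ^ S)⁻¹ * z⁻¹ ^ n) := by
  rw [show ((n + 1 : ℕ) : ℂ) - a = 1 - a + n by push_cast; ring, pow_succ, one_div, mul_inv,
    inv_pow, div_eq_mul_inv]
  ring

theorem norm_inv_lt_one_of_one_lt_norm {z : ℂ} (hz : 1 < ‖z‖) : ‖z⁻¹‖ < 1 := by
  rw [norm_inv]
  exact inv_lt_one_of_one_lt₀ hz

theorem summable_one_div_pow_div_zpow (a : ℂ) (S : ℤ) {z : ℂ} (hz : 1 < ‖z‖) :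
    Summable (fun n : ℕ => (1 / z ^ (n + 1)) / (((n + 1 : ℕ) : ℂ) - a) ^ S) := by
  simp only [one_div_pow_div_zpow_eq]
  exact ((summable_norm_zpow_mul_pow (1 - a) S (norm_inv_lt_one_of_one_lt_norm hz)).of_norm).mul_left _

theorem exp_neg_pi_mul_I_mul_intCast (S : ℤ) :
    exp (-((Real.pi : ℂ) * I * (S : ℂ))) = (-1) ^ S := by
  rw [show -((Real.pi : ℂ) * I * (S : ℂ)) = S * (-Real.pi * I) by ring, exp_int_mul,
    neg_mul, exp_neg_pi_mul_I]

/-- With `w = log (-z)`, the reflected series carries `e^{(1-a)(-w)} = e^{aw} e^{-w}`. The factor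
`e^{-w} = -1/z` supplies the minus sign and makes the sum start at `z⁻¹`. -/
theorem IsStripContinuation.lerchPhi_eq {a : ℂ} {S : ℤ} {P Psi : ℂ → ℂ}
    (h : IsStripContinuation a S P Psi) {z : ℂ} (hz : 1 < ‖z‖) (hd : z ∈ lerchDomain) :
    lerchPhi z S a = exp (-(a * log (-z))) * P (log (-z)) -
      exp (-((Real.pi : ℂ) * I * (S : ℂ))) *
        ∑' n : ℕ, (1 / z ^ (n + 1)) / (((n + 1 : ℕ) : ℂ) - a) ^ S := by
  have hF := h.isLerchContinuation
  have hs := neg_mem_slitPlane_of_one_le_norm hd hz.le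
  have h0 := slitPlane_ne_zero hs
  have hE : lerchPhi z S a = lerchGlue a S Psi z := hF.isLerchContinuation_lerchPhi.eqOn hF hd
  rw [hE, h.lerchGlue_eq hs, h.right _ (log_mem_logStrip hs)
    (by rw [log_re, norm_neg]; exact Real.log_pos hz), lerchExp_reflect, exp_neg (log (-z)),
    exp_log h0, exp_neg_pi_mul_I_mul_intCast]
  simp only [one_div_pow_div_zpow_eq, tsum_mul_left, inv_neg, neg_neg]
  have h3 : exp (-(a * log (-z))) * exp (a * log (-z)) = 1 := by
    rw [← exp_add, neg_add_cancel, exp_zero]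
  linear_combination (-((-1) ^ S * (z⁻¹ * ∑' n : ℕ, ((1 - a + n) ^ S)⁻¹ * z⁻¹ ^ n))) * h3

/-! ### The finite sum and the evaluation of the contour integral. -/

theorem lerchFiniteSum_of_nonpos (z a : ℂ) {S : ℤ} (hS : S ≤ 0) : lerchFiniteSum z S a = 0 := by
  rw [lerchFiniteSum, Int.toNat_eq_zero.2 hS]
  simp

theorem lerchFiniteSum_natCast_add_one (a : ℂ) (N : ℕ) {z : ℂ} (hz : z ≠ 0) :
    lerchFiniteSum z (N + 1) a =
      exp (-(a * log (-z))) * (2 * Real.pi * I * lerchPoly a N (log (-z))) := by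
  have h1 : ((N : ℤ) + 1).toNat = N + 1 := by lia
  rw [lerchFiniteSum, h1, cpow_def_of_ne_zero (neg_ne_zero.2 hz), mul_comm (log _) a, div_eq_mul_inv,
    ← exp_neg]
  have h2 : ∑ n ∈ Finset.range (N + 1), lerchCoeff a n / (Gamma (((N + 1 : ℤ) : ℂ) - (n : ℂ)) *
      log (-z) ^ ((n : ℤ) - (N + 1) + 1)) = lerchPoly a N (log (-z)) := by
    refine Finset.sum_congr rfl fun n hn => ?_
    obtain ⟨k, rfl⟩ := Nat.exists_eq_add_of_le (Nat.lt_succ_iff.1 (Finset.mem_range.1 hn))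
    rw [show (((n + k : ℕ) + 1 : ℤ) : ℂ) - n = k + 1 by push_cast; ring, Gamma_nat_eq_factorial,
      show (n : ℤ) - ((n + k : ℕ) + 1) + 1 = -k by push_cast; ring, zpow_neg, zpow_natCast,
      Nat.add_sub_cancel_left, ← div_eq_mul_inv, div_div_eq_mul_div, mul_div_assoc]
  rw [h2]
  ring

/-- The Mellin-Barnes integrand with the integer power removed. -/
noncomputable def barnesNumerator (z a t : ℂ) : ℂ :=
  2 * Real.pi * I * (lerchCsc a (t + a) * exp (t * log (-z)))

theorem Gamma_one_add_mul_Gamma_neg (t : ℂ) :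
    Gamma (1 + t) * Gamma (-t) = -(Real.pi / sin (Real.pi * t)) := by
  have h := Gamma_mul_Gamma_one_sub (-t)
  rw [sub_neg_eq_add, mul_neg, sin_neg, div_neg] at h
  rw [mul_comm, h]

theorem lerchKernel_eq {z : ℂ} (hz : z ≠ 0) (s a t l : ℂ) :
    lerchKernel z s t l = barnesNumerator z a t / exp (s * l) := by
  rw [lerchKernel, Gamma_one_add_mul_Gamma_neg, cpow_def_of_ne_zero (neg_ne_zero.2 hz),
    barnesNumerator, lerchCsc, add_sub_cancel_right, mul_comm t]
  congr 1
  linear_combination (-(Real.pi * exp (log (-z) * t) / sin (Real.pi * t))) * I_sq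

theorem exp_intCast_mul_log_add {r : ℝ} (hr : 0 < r) (S : ℤ) (θ : ℝ) :
    exp ((S : ℂ) * ((Real.log r : ℂ) + (θ : ℂ) * I)) = (r * exp (θ * I)) ^ S := by
  rw [exp_int_mul, exp_add, ← ofReal_exp, Real.exp_log hr]

/-- The arguments differ by `2π` and `S` is an integer, so the power `(a + t)^S` is the same on both
passages. -/
theorem lerchLeg_eq_lerchLeg (z a : ℂ) (S : ℤ) (y : ℝ) :
    lerchLeg z S a (3 * Real.pi / 2) y = lerchLeg z S a (-(Real.pi / 2)) y := by
  rw [lerchLeg, lerchLeg, lerchKernel, lerchKernel]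
  congr 2
  rw [exp_int_mul, exp_int_mul, exp_eq_exp_iff_exists_int.2 ⟨1, _⟩]
  push_cast
  ring

theorem integral_lerchArc {z : ℂ} (hz : z ≠ 0) (a : ℂ) (S : ℤ) {r : ℝ} (hr : 0 < r) :
    ∫ θ in (-(Real.pi / 2))..(3 * Real.pi / 2), lerchArc z S a r θ =
      ∮ t in C(-a, r), barnesNumerator z a t / (t + a) ^ S := by
  set f : ℂ → ℂ := fun t => barnesNumerator z a t / (t + a) ^ S
  have h1 : ∀ θ : ℝ, lerchArc z S a r θ =
      deriv (circleMap (-a) r) θ • f (circleMap (-a) r θ) := by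
    intro θ
    rw [lerchArc, lerchKernel_eq hz _ a, exp_intCast_mul_log_add hr, deriv_circleMap, smul_eq_mul]
    simp only [f, circleMap, neg_add_cancel_comm, zero_add]
    ring
  have h2 : Function.Periodic (fun θ : ℝ => deriv (circleMap (-a) r) θ • f (circleMap (-a) r θ))
      (2 * Real.pi) := by
    intro θ
    simp only [deriv_circleMap, periodic_circleMap _ _ θ]
  simp only [h1]
  have h3 := h2.intervalIntegral_add_eq (-(Real.pi / 2)) 0
  rw [zero_add, show -(Real.pi / 2) + 2 * Real.pi = 3 * Real.pi / 2 by ring] at h3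
  exact h3

/-- The legs cancel pointwise under the common integral, so no convergence is needed, even when the
half-line meets poles. -/
theorem lerchB_eq_circleIntegral {z : ℂ} (hz : z ≠ 0) (a : ℂ) (S : ℤ) {r : ℝ} (hr : 0 < r) :
    lerchB r z S a = 1 / (2 * Real.pi * I) *
      ∮ t in C(-a, r), barnesNumerator z a t / (t + a) ^ S := by
  rw [lerchB, integral_lerchArc hz a S hr]
  simp [lerchLeg_eq_lerchLeg]

theorem differentiableOn_barnesNumerator (z : ℂ) {a : ℂ} {r : ℝ} (hr : ∀ k : ℤ, r < ‖a - k‖) :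
    DifferentiableOn ℂ (barnesNumerator z a) (Metric.closedBall (-a) r) := by
  intro t ht
  refine DifferentiableAt.differentiableWithinAt ?_
  have h1 : DifferentiableAt ℂ (lerchCsc a) (t + a) := by
    refine differentiableAt_lerchCsc fun k hk => ?_
    rw [add_sub_cancel_right] at hk
    have h2 := hr (-k)
    rw [mem_closedBall_iff_norm, sub_neg_eq_add, hk, add_comm] at ht
    rw [Int.cast_neg, sub_neg_eq_add] at h2
    linarith
  have h2 : DifferentiableAt ℂ (fun t => lerchCsc a (t + a)) t :=
    h1.comp (f := fun t => t + a) t (by fun_prop)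
  exact (h2.mul (by fun_prop)).const_mul _

theorem iteratedDeriv_barnesNumerator (z : ℂ) {a : ℂ} (ha : ∀ k : ℤ, a ≠ k) (N : ℕ) :
    iteratedDeriv N (barnesNumerator z a) (-a) =
      2 * Real.pi * I * exp (-(a * log (-z))) * (N.factorial * lerchPoly a N (log (-z))) := by
  let G : ℂ → ℂ := fun u => 2 * Real.pi * I * exp (-(a * log (-z))) *
    (exp (u * log (-z)) * lerchCsc a u)
  have h : barnesNumerator z a = fun t => G (t + a) := by
    ext t
    simp only [G]
    have : exp (t * log (-z)) = exp (-(a * log (-z))) * exp ((t + a) * log (-z)) := by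
      rw [← exp_add]; ring_nf
    rw [barnesNumerator, this]
    ring
  rw [h, iteratedDeriv_comp_add_const N G a]
  beta_reduce
  rw [neg_add_cancel, iteratedDeriv_const_mul_field,
    iteratedDeriv_exp_mul_lerchCsc ha]

theorem lerchB_of_nonpos {z : ℂ} (hz : z ≠ 0) {a : ℂ} {S : ℤ} (hS : S ≤ 0) {r : ℝ} (hr : 0 < r)
    (h : ∀ k : ℤ, r < ‖a - k‖) : lerchB r z S a = 0 := by
  obtain ⟨m, rfl⟩ : ∃ m : ℕ, S = -m := ⟨S.natAbs, by lia⟩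
  rw [lerchB_eq_circleIntegral hz a _ hr]
  simp only [zpow_neg, zpow_natCast, div_inv_eq_mul]
  have h1 : DifferentiableOn ℂ (fun t => barnesNumerator z a t * (t + a) ^ m)
      (Metric.closedBall (-a) r) := (differentiableOn_barnesNumerator z h).mul (by fun_prop)
  rw [(h1.diffContOnCl_ball subset_rfl).circleIntegral_eq_zero hr.le, mul_zero]

/-- Cauchy's formula for the `N`-th derivative at `-a`. The poles of the numerator are integers,
hence outside the closed disk. -/
theorem lerchB_natCast_add_one {z : ℂ} (hz : z ≠ 0) {a : ℂ} (N : ℕ) {r : ℝ} (hr : 0 < r)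
    (h : ∀ k : ℤ, r < ‖a - k‖) :
    lerchB r z ((N + 1 : ℤ) : ℂ) a = lerchFiniteSum z (N + 1) a := by
  have ha : ∀ k : ℤ, a ≠ k := by
    rintro k rfl
    have := h k
    rw [sub_self, norm_zero] at this
    linarith
  have h1 := (differentiableOn_barnesNumerator z h).circleIntegral_one_div_sub_center_pow_smul hr N
  rw [iteratedDeriv_barnesNumerator z ha] at h1
  rw [lerchB_eq_circleIntegral hz a _ hr, lerchFiniteSum_natCast_add_one a N hz]
  have h2 : ∀ t, barnesNumerator z a t / (t + a) ^ (N + 1 : ℤ) =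
      (1 / (t - -a) ^ (N + 1)) • barnesNumerator z a t := by
    intro t
    rw [sub_neg_eq_add, smul_eq_mul, one_div_mul_eq_div]
    norm_cast
  simp only [h2]
  rw [h1]
  have h3 : (N.factorial : ℂ) ≠ 0 := by exact_mod_cast Nat.factorial_ne_zero N
  have h4 : (2 * Real.pi * I : ℂ) ≠ 0 := two_pi_I_ne_zero
  rw [smul_eq_mul]
  field_simp

/-! ### Absolute convergence along the half-line. -/

theorem exp_im_le_norm_sin {x : ℂ} (hx : 1 ≤ x.im) : Real.exp x.im / 4 ≤ ‖sin x‖ := by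
  have h1 : ‖sin x‖ = ‖exp (-x * I) - exp (x * I)‖ / 2 := by
    rw [sin, norm_div, norm_mul, norm_I, mul_one, RCLike.norm_ofNat]
  have h2 := norm_sub_norm_le (exp (-x * I)) (exp (x * I))
  rw [norm_exp, norm_exp] at h2
  simp only [neg_mul, neg_re, mul_I_re, neg_neg] at h2
  have h3 : Real.exp (-x.im) * 2 ≤ Real.exp x.im := by
    have h4 : Real.exp x.im = Real.exp (-x.im) * Real.exp (2 * x.im) := by
      rw [← Real.exp_add]; ring_nf
    rw [h4]
    have h5 := Real.add_one_le_exp (2 * x.im)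
    gcongr
    linarith
  rw [h1]
  simp only [neg_mul]
  linarith

theorem lerchLeg_eq {z : ℂ} (hz : z ≠ 0) (a : ℂ) (S : ℤ) (φ : ℝ) {y : ℝ} (hy : 0 < y) :
    lerchLeg z S a φ y = Real.pi / sin (Real.pi * (a + y * I)) *
      exp (-((a + y * I) * log (-z))) / (y * exp (φ * I)) ^ S * (-I) := by
  rw [lerchLeg, lerchKernel, Gamma_one_add_mul_Gamma_neg, cpow_def_of_ne_zero (neg_ne_zero.2 hz),
    exp_intCast_mul_log_add hy, show -a - (y : ℂ) * I = -(a + y * I) by ring, mul_neg (Real.pi : ℂ), sin_neg,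
    div_neg, neg_neg, mul_neg (log (-z)), mul_comm (log (-z))]

open Filter Asymptotics in
theorem isBigO_lerchLeg {z : ℂ} (hz : -z ∈ slitPlane) (a : ℂ) (S : ℤ) (φ : ℝ) :
    (fun y => ‖lerchLeg z S a φ y‖) =O[atTop]
      fun y => Real.exp (-((Real.pi - arg (-z)) / 2) * y) := by
  have h0 : z ≠ 0 := by simpa using slitPlane_ne_zero hz
  -- The cosecant and `(-z)^t` together decay like `e^{-(π - arg(-z)) y}`. Half of this rate is
  -- spent on absorbing `y^{-S}`.
  have hb : 0 < (Real.pi - arg (-z)) / 2 :=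
    half_pos (sub_pos.2 (lt_of_le_of_ne (arg_le_pi _) (mem_slitPlane_iff_arg.1 hz).1))
  have h1 := ((isLittleO_zpow_exp_pos_mul_atTop (-S) hb).isBigO.mul
    (isBigO_refl (fun y => Real.exp (-(Real.pi - arg (-z)) * y)) atTop)).const_mul_left
    (4 * Real.pi * Real.exp (-(Real.pi * a.im)) * Real.exp (-(a * log (-z))).re)
  refine IsBigO.trans (IsBigO.of_bound 1 ?_) (h1.congr_right fun y => ?_)
  -- The threshold gives `π (Im a + y) ≥ 1`, as the lower bound for the sine requires.
  · filter_upwards [eventually_gt_atTop 0, eventually_ge_atTop (1 / Real.pi - a.im)] with y hy hy1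
    have him : ((Real.pi : ℂ) * (a + y * I)).im = Real.pi * (a.im + y) := by simp
    have h2 := exp_im_le_norm_sin (x := Real.pi * (a + y * I)) (by
      rw [him]
      have := mul_le_mul_of_nonneg_left hy1 Real.pi_pos.le
      rw [mul_sub, mul_one_div_cancel Real.pi_ne_zero] at this
      linarith)
    rw [him] at h2
    have h3 : Real.pi / ‖sin (Real.pi * (a + y * I))‖ ≤
        Real.pi * (4 * Real.exp (-(Real.pi * (a.im + y)))) := by
      rw [div_eq_mul_inv]
      gcongr
      calc _ ≤ (Real.exp (Real.pi * (a.im + y)) / 4)⁻¹ := inv_anti₀ (by positivity) h2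
        _ = _ := by rw [inv_div, Real.exp_neg, div_eq_mul_inv]
    have h4 : ‖exp (-((a + y * I) * log (-z)))‖ =
        Real.exp (-(a * log (-z))).re * Real.exp (arg (-z) * y) := by
      rw [norm_exp, ← Real.exp_add]
      congr 1
      simp [log_im]
      ring
    have h5 : Real.exp (-(Real.pi * (a.im + y))) * Real.exp (arg (-z) * y) =
        Real.exp (-(Real.pi * a.im)) * Real.exp (-(Real.pi - arg (-z)) * y) := by
      rw [← Real.exp_add, ← Real.exp_add]
      ring_nf
    rw [lerchLeg_eq h0 a S φ hy, one_mul, norm_norm, norm_mul, norm_div, norm_mul, norm_div,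
      norm_zpow, norm_mul, norm_exp_ofReal_mul_I, norm_real, norm_real, norm_neg, norm_I, mul_one,
      mul_one, Real.norm_of_nonneg hy.le, Real.norm_of_nonneg Real.pi_pos.le, h4,
      Real.norm_of_nonneg (by positivity), zpow_neg, div_eq_mul_inv]
    calc _ ≤ Real.pi * (4 * Real.exp (-(Real.pi * (a.im + y)))) *
          (Real.exp (-(a * log (-z))).re * Real.exp (arg (-z) * y)) * (y ^ S)⁻¹ := by gcongr
      _ = _ := by linear_combination (4 * Real.pi * Real.exp (-(a * log (-z))).re * (y ^ S)⁻¹) * h5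
  · rw [← Real.exp_add]
    ring_nf

theorem continuousOn_lerchLeg {z : ℂ} (hz : z ≠ 0) {a : ℂ} (S : ℤ) (φ : ℝ) {r : ℝ} (hr : 0 < r)
    (h : ∀ k : ℤ, ∀ y : ℝ, 0 ≤ y → a ≠ k - y * I) : ContinuousOn (lerchLeg z S a φ) (Ici r) := by
  have h1 : ∀ y ∈ Ici r, sin (Real.pi * (a + y * I)) ≠ 0 := fun y hy =>
    sin_pi_mul_ne_zero_of_ne_intCast fun k hk =>
      h k y (hr.le.trans hy) (eq_sub_of_add_eq hk)
  have h2 : ∀ y ∈ Ici r, (y : ℂ) * exp (φ * I) ≠ 0 := fun y hy =>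
    mul_ne_zero (ofReal_ne_zero.2 (hr.trans_le hy).ne') (exp_ne_zero _)
  refine ContinuousOn.congr ?_ fun y hy => lerchLeg_eq hz a S φ (hr.trans_le hy)
  refine (((continuousOn_const.div ?_ h1).mul ?_).div
    (ContinuousOn.zpow₀ ?_ S fun y hy => Or.inl (h2 y hy)) fun y hy => zpow_ne_zero _ (h2 y hy)).mul
    continuousOn_const
  all_goals exact Continuous.continuousOn (by fun_prop)

theorem integrableOn_lerchLeg {z : ℂ} (hz : -z ∈ slitPlane) {a : ℂ} (S : ℤ) (φ : ℝ) {r : ℝ}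
    (hr : 0 < r) (h : ∀ k : ℤ, ∀ y : ℝ, 0 ≤ y → a ≠ k - y * I) :
    IntegrableOn (lerchLeg z S a φ) (Ioi r) := by
  have h0 : z ≠ 0 := by simpa using slitPlane_ne_zero hz
  have hb : 0 < (Real.pi - arg (-z)) / 2 :=
    half_pos (sub_pos.2 (lt_of_le_of_ne (arg_le_pi _) (mem_slitPlane_iff_arg.1 hz).1))
  have hc := continuousOn_lerchLeg h0 S φ hr h
  exact (integrable_norm_iff ((hc.mono Ioi_subset_Ici_self).aestronglyMeasurable
    measurableSet_Ioi)).1 (integrable_of_isBigO_exp_neg hb hc.norm (isBigO_lerchLeg hz a S φ))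

/-! ### Assembly. -/

theorem mainTheorem2 (S : ℤ) (a : ℂ) (ha : 1 ≤ S → ∀ k : ℤ, a ≠ (k : ℂ)) :
    IsLerchContinuation (S : ℂ) a (fun z => lerchPhi z (S : ℂ) a) ∧
    ∀ z : ℂ, 1 < ‖z‖ → z ∈ lerchDomain →
      (∀ r : ℝ, 0 < r → (∀ k : ℤ, r < ‖a - (k : ℂ)‖) →
        ((∀ k : ℤ, ∀ y : ℝ, 0 ≤ y → a ≠ (k : ℂ) - (y : ℂ) * Complex.I) →
          IntegrableOn (lerchLeg z (S : ℂ) a (-(Real.pi / 2))) (Ioi r) ∧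
          IntegrableOn (lerchLeg z (S : ℂ) a (3 * Real.pi / 2)) (Ioi r)) ∧
        (S ≤ 0 → lerchB r z (S : ℂ) a = 0) ∧
        (1 ≤ S → lerchB r z (S : ℂ) a = lerchFiniteSum z S a) ∧
        lerchPhi z (S : ℂ) a = lerchB r z (S : ℂ) a -
          Complex.exp (-((Real.pi : ℂ) * Complex.I * (S : ℂ))) *
            ∑' n : ℕ, (1 / z ^ (n + 1)) / (((n + 1 : ℕ) : ℂ) - a) ^ S) ∧
      Summable (fun n : ℕ => (1 / z ^ (n + 1)) / (((n + 1 : ℕ) : ℂ) - a) ^ S) ∧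
      lerchPhi z (S : ℂ) a = lerchFiniteSum z S a -
        Complex.exp (-((Real.pi : ℂ) * Complex.I * (S : ℂ))) *
          ∑' n : ℕ, (1 / z ^ (n + 1)) / (((n + 1 : ℕ) : ℂ) - a) ^ S := by
  have key : ∃ P F : ℂ → ℂ, IsStripContinuation a S P F ∧ ∀ z : ℂ, z ≠ 0 →
      exp (-(a * log (-z))) * P (log (-z)) = lerchFiniteSum z S a := by
    rcases le_or_gt S 0 with hS | hS
    · obtain ⟨m, rfl⟩ : ∃ m : ℕ, S = -m := ⟨S.natAbs, by lia⟩
      obtain ⟨F, hF⟩ := exists_isStripContinuation_of_nonpos a m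
      exact ⟨0, F, hF, fun z _ => by simp [lerchFiniteSum_of_nonpos z a hS]⟩
    · obtain ⟨N, rfl⟩ : ∃ N : ℕ, S = N + 1 := ⟨(S - 1).natAbs, by lia⟩
      obtain ⟨F, hF⟩ := exists_isStripContinuation_of_pos (ha (by lia)) N
      exact ⟨_, F, hF, fun z hz => (lerchFiniteSum_natCast_add_one a N hz).symm⟩
  obtain ⟨P, F, hF, hP⟩ := key
  refine ⟨hF.isLerchContinuation.isLerchContinuation_lerchPhi, fun z hz hd => ?_⟩
  have hs := neg_mem_slitPlane_of_one_le_norm hd hz.le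
  have h0 : z ≠ 0 := by simpa using slitPlane_ne_zero hs
  have hPhi := hF.lerchPhi_eq hz hd
  rw [hP z h0] at hPhi
  refine ⟨fun r hr hk => ?_, summable_one_div_pow_div_zpow a S hz, hPhi⟩
  have hB0 : S ≤ 0 → lerchB r z S a = 0 := fun hS => lerchB_of_nonpos h0 hS hr hk
  have hB1 : 1 ≤ S → lerchB r z S a = lerchFiniteSum z S a := by
    intro hS
    obtain ⟨N, rfl⟩ : ∃ N : ℕ, S = N + 1 := ⟨(S - 1).natAbs, by lia⟩
    exact lerchB_natCast_add_one h0 N hr hk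
  refine ⟨fun h => ⟨integrableOn_lerchLeg hs S _ hr h, integrableOn_lerchLeg hs S _ hr h⟩,
    hB0, hB1, ?_⟩
  rw [hPhi]
  rcases le_or_gt S 0 with hS | hS
  · rw [hB0 hS, lerchFiniteSum_of_nonpos z a hS]
  · rw [hB1 hS]
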